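/- Let $G$ be a group acting on finite non-empty sets $X$ and $Y$, and diagonally on $X\times Y$ by $g(x,y)=(gx,gy)$. Write $G(x)$ for the orbit of $x$, and let $m_1$, $n_1$, $m_{12}$ be the numbers of $G$-orbits in $X$, $Y$ and $X\times Y$. For $G$-invariant probability measures $\mu_1$ on $X$ and $\mu_2$ on $Y$ with full support, let $E(\mu_1,\mu_2)$ be the set of extreme points of the convex set of all $G$-invariant probability measures on $X\times Y$ with marginals $\mu_1$ and $\mu_2$. A $G$-invariant set $S\subset X\times Y$ is called $G$-good if every $G$-invariant real function $f$ on $S$ can be written as $f(x,y)=u(x)+v(y)$ for all $(x,y)\in S$, with $G$-invariant functions $u$ on $X$ and $v$ on $Y$; it is maximal $G$-good if it is maximal under inclusion among the $G$-good sets. (i) There is a constant $C$ such that for all integers $m,n\ge 2$ $$\frac{m^{n-1}n^{m-1}}{\binom{mn}{m+n-1}}\le C\,\frac{(1-\frac1m)^{mn}(1+\frac nm)^m(1-\frac1n)^{mn}(1+\frac mn)^n}{(1-\frac1m)^n(1-\frac1n)^m(m+n)^{1/2}}.$$ (ii) $m^{n-1}n^{m-1}/\binom{mn}{m+n-1}\to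 0$ as $m,n\to\infty$ (jointly). (iii) If $G$ acts trivially on $X$ and $Y$, then $m_{12}=m_1n_1$ and the number of maximal $G$-good sets in $X\times Y$ is $m_1^{n_1-1}n_1^{m_1-1}$. More generally, if the number of $G$-orbits in $G(x)\times G(y)$ is the same number $a$ for all $x\in X$, $y\in Y$, then $m_{12}=a\,m_1n_1$ and the number of maximal $G$-good sets in $X\times Y$ is $a^{m_1+n_1-1}m_1^{n_1-1}n_1^{m_1-1}$. (iv) $E(\mu_1,\mu_2)$ is finite, and $|E(\mu_1,\mu_2)|$ is at most the number of maximal $G$-good sets in $X\times Y$. (v) For every $\varepsilon>0$ there is $N$ such that, for all $G,X,Y,\mu_1,\mu_2$ as above for which $G$ acts trivially on $X$ and $Y$ or the number of $G$-orbits in $G(x)\times G(y)$ is independent of $x$ and $y$, if $m_1\ge N$ and $n_1\ge N$, then $$\frac{|E(\mu_1,\mu_2)|}{\binom{m_{12}}{m_1+n_1-1}}<\varepsilon .$$ That is, in these two cases the ratio tends to $0$ as $m_1,n_1\to\infty$. -/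

import Mathlib

open Filter Topology

namespace FixedMarginals

/-- The number of `G`-orbits in a set `Z` on which `G` acts. -/
noncomputable def numOrbits (G Z : Type*) [Group G] [MulAction G Z] : ℕ :=
  Nat.card (MulAction.orbitRel.Quotient G Z)

/-- The number of `G`-orbits of the diagonal action on `X × Y` that are contained in the
`G`-invariant set `G(x) × G(y)`. -/
noncomputable def numOrbitsIn (G : Type*) {X Y : Type*} [Group G] [MulAction G X] [MulAction G Y]
    (x : X) (y : Y) : ℕ :=
  Set.ncard {o : MulAction.orbitRel.Quotient G (X × Y) |
    o.orbit ⊆ MulAction.orbit G x ×ˢ MulAction.orbit G y}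

/-- The action of `G` on `Z` is trivial: every element of `G` fixes every point. -/
def ActsTrivially (G Z : Type*) [Group G] [MulAction G Z] : Prop :=
  ∀ (g : G) (z : Z), g • z = z

/-- A real function on `Z` is `G`-invariant. -/
def IsInvariantFun (G : Type*) {Z : Type*} [Group G] [MulAction G Z] (f : Z → ℝ) : Prop :=
  ∀ (g : G) (z : Z), f (g • z) = f z

/-- `G`-invariant probability measures on a finite set `Z`, given by their point masses. -/
def invariantProb (G Z : Type*) [Group G] [MulAction G Z] [Fintype Z] : Set (Z → ℝ) :=
  {μ | μ ∈ stdSimplex ℝ Z ∧ IsInvariantFun G μ}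

/-- The convex set `K(μ₁, μ₂)` of all `G`-invariant probability measures on `X × Y`
with marginals `μ₁` and `μ₂`. -/
def couplings (G : Type*) {X Y : Type*} [Group G] [MulAction G X] [MulAction G Y]
    [Fintype X] [Fintype Y] (μ₁ : X → ℝ) (μ₂ : Y → ℝ) : Set (X × Y → ℝ) :=
  {μ | μ ∈ invariantProb G (X × Y) ∧
    (∀ x, ∑ y, μ (x, y) = μ₁ x) ∧ (∀ y, ∑ x, μ (x, y) = μ₂ y)}

/-- The set `E(μ₁, μ₂)` of extreme points of `K(μ₁, μ₂)`. -/
def extremeCouplings (G : Type*) {X Y : Type*} [Group G] [MulAction G X] [MulAction G Y]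
    [Fintype X] [Fintype Y] (μ₁ : X → ℝ) (μ₂ : Y → ℝ) : Set (X × Y → ℝ) :=
  (couplings G μ₁ μ₂).extremePoints ℝ

/-- A `G`-invariant set `S ⊆ X × Y` is `G`-good if every real `G`-invariant function on `S`
has the form `u(x) + v(y)` on `S` with `G`-invariant `u` and `v`. (A function on `S` is given
here by an arbitrary extension to `X × Y`; only its values on `S` matter.) -/
def IsGood (G : Type*) {X Y : Type*} [Group G] [MulAction G X] [MulAction G Y]
    (S : Set (X × Y)) : Prop :=
  (∀ (g : G), ∀ p ∈ S, g • p ∈ S) ∧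
  ∀ f : X × Y → ℝ, (∀ (g : G), ∀ p ∈ S, f (g • p) = f p) →
    ∃ (u : X → ℝ) (v : Y → ℝ), IsInvariantFun G u ∧ IsInvariantFun G v ∧
      ∀ p ∈ S, f p = u p.1 + v p.2

/-- The number of `G`-good subsets of `X × Y` that are maximal for inclusion. -/
noncomputable def numMaximalGood (G X Y : Type*) [Group G] [MulAction G X] [MulAction G Y] : ℕ :=
  Set.ncard {S : Set (X × Y) | Maximal (IsGood G) S}

end FixedMarginals

/-!
The orbits of `G` in `X` and in `Y` are the vertices, and the orbits in `X × Y` the edges, of a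
bipartite multigraph: the orbit of `(x, y)` joins the orbit of `x` to that of `y`. Invariant sets
are sets of edges, and a set is `G`-good exactly when every function on its edges is a sum of a
function of the first and a function of the second end point, that is, when the columns of the
incidence matrix belonging to it are linearly independent (`FixedMarginals.isGood_preimage_iff`,
`splits_iff_linearIndepOn`). Thus the maximal good sets are the bases among these columns, i.e. the
spanning trees.

They are counted by the argument behind the matrix-tree theorem. Let `M` be the incidence matrix
with one row removed. By Cauchy–Binet (`sum_det_submatrix_sq`), `det (M * Mᵀ)` is the sum of the
squares of the maximal minors, and each minor is `0` or `±1` because incidence matrices of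
bipartite graphs are totally unimodular (`det_incidence_submatrix_mem`). When any two vertices on
opposite sides are joined by `a` edges, `M * Mᵀ` has scalar diagonal blocks and constant
off-diagonal blocks, and its determinant is explicit (`ncard_maximal_splits`).

The support of an extreme coupling is good: otherwise it carries a non-zero invariant signed
measure with zero marginals, along which the coupling can be moved in both directions. Conversely
a good set carries at most one coupling. Choosing a maximal good set that contains the support is
therefore an injection (`FixedMarginals.extremeCouplings_finite_and_ncard_le`).

For the asymptotics, two-sided Stirling bounds valid for all `n` give the estimate with constant
`e ^ 3`, and each of the two symmetric factors of its right-hand side, apart from the square root,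
is at most `e` once `m, n ≥ 4` (`stirlingFactor_le`), so the ratio is `O((m + n) ^ (-1/2))`. The
common multiplicity `a` drops out since `a ^ k * N.choose k ≤ (a * N).choose k`.
-/

/-! ### Stirling estimates -/

/-- The upper Stirling bound with constant `e`: the sequence `n! / (√(2n) (n/e)ⁿ)` is decreasing
and has the value `e / √2` at `n = 1`. -/
theorem factorial_le_stirling {n : ℕ} (hn : n ≠ 0) :
    (n.factorial : ℝ) ≤ Real.exp 1 * √n * (n / Real.exp 1) ^ n := by
  obtain ⟨k, rfl⟩ := Nat.exists_eq_succ_of_ne_zero hn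
  have h := Stirling.stirlingSeq'_antitone (Nat.zero_le k)
  simp only [Function.comp, Nat.succ_eq_add_one, zero_add] at h ⊢
  rw [Stirling.stirlingSeq_one, Stirling.stirlingSeq, div_le_iff₀ (by positivity)] at h
  refine h.trans_eq ?_
  rw [Real.sqrt_mul (by norm_num)]
  field_simp

theorem sqrt_mul_pow_le_factorial (n : ℕ) :
    √n * (n / Real.exp 1) ^ n ≤ (n.factorial : ℝ) := by
  refine le_trans ?_ (Stirling.le_factorial_stirling n)
  gcongr
  nlinarith [Real.pi_gt_three, (Nat.cast_nonneg n : (0 : ℝ) ≤ n)]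

/-- Stirling bound for `1 / (mn choose m+n-1)`, with `m = k + 1` and `n = l + 1`. Then
`mn - (m+n-1) = kl`, so no truncated subtraction occurs. -/
theorem inv_choose_mul_le {k l : ℕ} (hk : k ≠ 0) (hl : l ≠ 0) :
    1 / (((k + 1) * (l + 1)).choose (k + l + 1) : ℝ) ≤
      Real.exp 1 * ((k + 1 + (l + 1) : ℝ) ^ (k + 1 + (l + 1)) * (k * l : ℝ) ^ (k * l) /
        (((k + 1) * (l + 1) : ℝ) ^ ((k + 1) * (l + 1)) * √((k + 1 : ℝ) + (l + 1)))) := by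
  have hsub : (k + 1) * (l + 1) - (k + l + 1) = k * l := by
    rw [show (k + 1) * (l + 1) = k * l + (k + l + 1) by ring]; simp
  have hle : k + l + 1 ≤ (k + 1) * (l + 1) := by nlinarith [Nat.zero_le (k * l)]
  rw [Nat.cast_choose ℝ hle, hsub, one_div_div]
  have hk0 : (0 : ℝ) < k := by positivity
  have hl0 : (0 : ℝ) < l := by positivity
  have e0 := Real.exp_pos 1
  have h1 := factorial_le_stirling (n := k + 1 + (l + 1)) (by omega)
  have h2 := factorial_le_stirling (n := k * l) (by positivity)
  have h3 := sqrt_mul_pow_le_factorial ((k + 1) * (l + 1))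
  have h4 : ((k + l + 1).factorial : ℝ) = (k + 1 + (l + 1)).factorial / ((k + 1 : ℝ) + (l + 1)) := by
    rw [show k + 1 + (l + 1) = k + l + 1 + 1 by ring, Nat.factorial_succ (k + l + 1)]
    push_cast
    field_simp
    ring
  push_cast at h1 h2 h3
  rw [h4]
  have hs : √((k : ℝ) * l) ≤ √(((k : ℝ) + 1) * (l + 1)) := by gcongr <;> linarith
  calc _ ≤ (Real.exp 1 * √((k : ℝ) + 1 + (l + 1)) *
            (((k : ℝ) + 1 + (l + 1)) / Real.exp 1) ^ (k + 1 + (l + 1)) / ((k + 1 : ℝ) + (l + 1)) *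
            (Real.exp 1 * √(((k : ℝ) + 1) * (l + 1)) * ((k : ℝ) * l / Real.exp 1) ^ (k * l))) /
            (√(((k : ℝ) + 1) * (l + 1)) *
              (((k : ℝ) + 1) * (l + 1) / Real.exp 1) ^ ((k + 1) * (l + 1))) := by
          gcongr
          exact h2.trans (by gcongr)
    _ = _ := by
      have hsq : ((k : ℝ) + 1 + (l + 1)) = √((k : ℝ) + 1 + (l + 1)) * √((k : ℝ) + 1 + (l + 1)) :=
        (Real.mul_self_sqrt (by positivity)).symm
      have hexp : Real.exp 1 ^ ((k + 1) * (l + 1)) * Real.exp 1 =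
          Real.exp 1 ^ (k + 1 + (l + 1)) * Real.exp 1 ^ (k * l) := by
        rw [← pow_add, ← pow_succ]; congr 1; ring
      have hs0 : 0 < √((k : ℝ) + 1 + (l + 1)) := by positivity
      have hs1 : 0 < √(((k : ℝ) + 1) * (l + 1)) := by positivity
      rw [div_pow, div_pow, div_pow]
      generalize ((k : ℝ) + 1 + (l + 1)) ^ (k + 1 + (l + 1)) = P
      generalize ((k : ℝ) * l) ^ (k * l) = Q
      have hR : 0 < (((k : ℝ) + 1) * (l + 1)) ^ ((k + 1) * (l + 1)) := by positivity
      generalize (((k : ℝ) + 1) * (l + 1)) ^ ((k + 1) * (l + 1)) = R at *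
      have ha : 0 < Real.exp 1 ^ ((k + 1) * (l + 1)) := by positivity
      have hb : 0 < Real.exp 1 ^ (k + 1 + (l + 1)) := by positivity
      have hc : 0 < Real.exp 1 ^ (k * l) := by positivity
      generalize Real.exp 1 ^ ((k + 1) * (l + 1)) = a at *
      generalize Real.exp 1 ^ (k + 1 + (l + 1)) = b at *
      generalize Real.exp 1 ^ (k * l) = c at *
      generalize √(((k : ℝ) + 1) * (l + 1)) = s at *
      generalize √((k : ℝ) + 1 + (l + 1)) = t at *
      rw [hsq]
      field_simp
      linear_combination (P * Q) * hexp

/-- The factors with bases `1 - 1/m` and `1 + n/m` in the Stirling bound; the other factors, apart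
from the square root, are those of `stirlingFactor n m`. -/
noncomputable def stirlingFactor (m n : ℕ) : ℝ :=
  (1 - 1 / (m : ℝ)) ^ (m * n) * (1 + (n : ℝ) / m) ^ m / (1 - 1 / (m : ℝ)) ^ n

theorem one_add_inv_pow_le (k : ℕ) : ((k + 1 : ℝ) / k) ^ k ≤ Real.exp 1 := by
  rcases Nat.eq_zero_or_pos k with rfl | hk
  · simp
  have hk' : (0 : ℝ) < k := by positivity
  calc ((k + 1 : ℝ) / k) ^ k ≤ (Real.exp (1 / k)) ^ k := by
        gcongr
        have := Real.add_one_le_exp (1 / (k : ℝ))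
        rw [add_div, div_self hk'.ne']
        linarith
    _ = Real.exp 1 := by rw [← Real.exp_nat_mul]; congr 1; field_simp

theorem stirlingFactor_succ (k n : ℕ) (hk : k ≠ 0) :
    stirlingFactor (k + 1) n =
      ((k : ℝ) / (k + 1)) ^ (k * n) * ((k + 1 + n : ℝ) / (k + 1)) ^ (k + 1) := by
  have hk0 : (0 : ℝ) < k := by positivity
  have h1 : (1 - 1 / ((k + 1 : ℕ) : ℝ)) = (k : ℝ) / (k + 1) := by
    push_cast; field_simp; ring
  have h2 : (1 + (n : ℝ) / ((k + 1 : ℕ) : ℝ)) = (k + 1 + n : ℝ) / (k + 1) := by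
    push_cast; field_simp
  rw [stirlingFactor, h1, h2, show (k + 1) * n = k * n + n by ring, pow_add]
  have : 0 < ((k : ℝ) / (k + 1)) ^ n := by positivity
  field_simp

theorem stirlingFactor_nonneg (m n : ℕ) (hm : 2 ≤ m) : 0 ≤ stirlingFactor m n := by
  obtain ⟨k, rfl⟩ : ∃ k, m = k + 1 := ⟨m - 1, by omega⟩
  rw [stirlingFactor_succ k n (by omega)]
  positivity

theorem ratio_le_stirlingFactor {m n : ℕ} (hm : 2 ≤ m) (hn : 2 ≤ n) :
    (m : ℝ) ^ (n - 1) * (n : ℝ) ^ (m - 1) / (Nat.choose (m * n) (m + n - 1) : ℝ) ≤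
      Real.exp 1 ^ 3 * (stirlingFactor m n * stirlingFactor n m / √((m : ℝ) + n)) := by
  obtain ⟨k, rfl⟩ : ∃ k, m = k + 1 := ⟨m - 1, by omega⟩
  obtain ⟨l, rfl⟩ : ∃ k, n = k + 1 := ⟨n - 1, by omega⟩
  have hk : k ≠ 0 := by omega
  have hl : l ≠ 0 := by omega
  have hk0 : (0 : ℝ) < k := by positivity
  have hl0 : (0 : ℝ) < l := by positivity
  have h := inv_choose_mul_le hk hl
  rw [stirlingFactor_succ _ _ hk, stirlingFactor_succ _ _ hl, div_eq_mul_one_div]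
  rw [show k + 1 + (l + 1) - 1 = k + l + 1 by omega]
  simp only [Nat.add_sub_cancel]
  push_cast
  have e0 := Real.exp_pos 1
  have hek := one_add_inv_pow_le k
  have hel := one_add_inv_pow_le l
  calc _ ≤ ((k : ℝ) + 1) ^ l * ((l : ℝ) + 1) ^ k * (Real.exp 1 *
        ((k + 1 + (l + 1) : ℝ) ^ (k + 1 + (l + 1)) * (k * l : ℝ) ^ (k * l) /
        (((k + 1) * (l + 1) : ℝ) ^ ((k + 1) * (l + 1)) * √((k + 1 : ℝ) + (l + 1))))) := by gcongr
    _ = Real.exp 1 * (((k + 1 : ℝ) / k) ^ k * ((l + 1 : ℝ) / l) ^ l) *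
        (((k : ℝ) / (k + 1)) ^ (k * (l + 1)) * ((k + 1 + (l + 1) : ℝ) / (k + 1)) ^ (k + 1) *
        (((l : ℝ) / (l + 1)) ^ (l * (k + 1)) * ((l + 1 + (k + 1) : ℝ) / (l + 1)) ^ (l + 1)) /
          √((k + 1 : ℝ) + (l + 1))) := by
      rw [add_comm ((l : ℝ) + 1) (k + 1)]
      simp only [div_pow, mul_pow]
      rw [pow_add ((k : ℝ) + 1 + (l + 1)), show (k + 1) * (l + 1) = k * l + k + l + 1 by ring,
        show k * (l + 1) = k * l + k by ring, show l * (k + 1) = k * l + l by ring]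
      simp only [pow_add, pow_one]
      have : (0 : ℝ) < √((k + 1 : ℝ) + (l + 1)) := by positivity
      field_simp
    _ ≤ Real.exp 1 * (Real.exp 1 * Real.exp 1) * _ := by gcongr
    _ = _ := by ring

/-- With `t = n / m`, the logarithm of `stirlingFactor m n` is at most
`m * log (1 + t) - n + t`. For `t ≤ 1` this is at most `t`, since `log (1 + t) ≤ t`; for `t ≥ 1` it
is at most `0`, since then `log (1 + t) ≤ 3 t / 4` and `m ≥ 4`. -/
theorem stirlingFactor_le {m n : ℕ} (hm : 4 ≤ m) : stirlingFactor m n ≤ Real.exp 1 := by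
  obtain ⟨k, rfl⟩ : ∃ k, m = k + 1 := ⟨m - 1, by omega⟩
  have hk : (3 : ℝ) ≤ k := by exact_mod_cast (by omega : 3 ≤ k)
  have hk0 : (0 : ℝ) < k := by linarith
  rw [stirlingFactor_succ k n (by omega), ← Real.log_le_iff_le_exp (by positivity),
    Real.log_mul (by positivity) (by positivity), Real.log_pow, Real.log_pow]
  have hn : (0 : ℝ) ≤ n := Nat.cast_nonneg n
  -- the bound `log (1 + x) ≥ 2 x / (x + 2)` at `x = 1 / k`
  have h1 : Real.log ((k : ℝ) / (k + 1)) ≤ - (2 / (2 * k + 1)) := by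
    have := Real.le_log_one_add_of_nonneg (x := 1 / (k : ℝ)) (by positivity)
    rw [show (k : ℝ) / (k + 1) = (1 + 1 / (k : ℝ))⁻¹ by field_simp, Real.log_inv]
    refine neg_le_neg (le_trans (le_of_eq ?_) this)
    field_simp
    ring
  have h2 : ((k * n : ℕ) : ℝ) * Real.log ((k : ℝ) / (k + 1)) ≤ - n + n / (k + 1) := by
    calc _ ≤ ((k * n : ℕ) : ℝ) * (- (2 / (2 * k + 1))) := by gcongr
      _ = - n + n / (2 * k + 1) := by push_cast; field_simp; ring
      _ ≤ _ := by gcongr; linarith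
  set t : ℝ := n / (k + 1) with ht
  have ht0 : 0 ≤ t := by positivity
  have htn : (n : ℝ) = (k + 1) * t := by rw [ht]; field_simp
  have hq : ((k : ℝ) + 1 + n) / (k + 1) = 1 + t := by rw [ht]; field_simp
  rw [hq]
  push_cast at h2 ⊢
  rcases le_or_gt t 1 with h | h
  · have h3 : Real.log (1 + t) ≤ t := by
      have := Real.log_le_sub_one_of_pos (x := 1 + t) (by positivity); linarith
    have : ((k : ℝ) + 1) * Real.log (1 + t) ≤ (k + 1) * t := by gcongr
    linarith
  · -- the tangent at `t = 1`
    have h3 : Real.log (1 + t) ≤ 3 / 4 * t := by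
      have h4 := Real.log_le_sub_one_of_pos (x := (1 + t) / 2) (by positivity)
      rw [Real.log_div (by positivity) (by norm_num)] at h4
      have := Real.log_two_lt_d9
      linarith
    have : ((k : ℝ) + 1) * Real.log (1 + t) ≤ (k + 1) * (3 / 4 * t) := by gcongr
    nlinarith

theorem tendsto_ratio :
    Tendsto (fun p : ℕ × ℕ =>
        (p.1 : ℝ) ^ (p.2 - 1) * (p.2 : ℝ) ^ (p.1 - 1) /
          (Nat.choose (p.1 * p.2) (p.1 + p.2 - 1) : ℝ))
      (atTop ×ˢ atTop) (𝓝 0) := by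
  have hlim : Tendsto (fun p : ℕ × ℕ => Real.exp 1 ^ 3 *
      (Real.exp 1 * Real.exp 1 / √((p.1 : ℝ) + p.2))) (atTop ×ˢ atTop) (𝓝 0) := by
    rw [← mul_zero (Real.exp 1 ^ 3)]
    refine Tendsto.const_mul _ (Tendsto.div_atTop tendsto_const_nhds ?_)
    refine Real.tendsto_sqrt_atTop.comp (Tendsto.atTop_add_atTop ?_ ?_)
    · exact tendsto_natCast_atTop_atTop.comp tendsto_fst
    · exact tendsto_natCast_atTop_atTop.comp tendsto_snd
  refine squeeze_zero' (Eventually.of_forall fun p => by positivity) ?_ hlim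
  filter_upwards [(eventually_ge_atTop 4).prod_mk (eventually_ge_atTop 4)] with p hp
  refine (ratio_le_stirlingFactor (by omega) (by omega)).trans ?_
  gcongr
  · exact stirlingFactor_nonneg _ _ (by omega)
  · exact stirlingFactor_le hp.1
  · exact stirlingFactor_le hp.2

/-! ### The Cauchy–Binet formula and incidence matrices -/

section CauchyBinet
open Equiv Finset

variable {ι Ω R : Type*} [Fintype ι] [DecidableEq ι] [Fintype Ω] [CommRing R]

theorem det_mul_eq_sum_prod_mul_det (M : Matrix ι Ω R) (N : Matrix Ω ι R) :
    (M * N).det = ∑ f : ι → Ω, (∏ i, N (f i) i) * (M.submatrix id f).det := by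
  simp only [Matrix.det_apply', Matrix.mul_apply, prod_univ_sum, mul_sum, Fintype.piFinset_univ]
  rw [Finset.sum_comm]
  refine Finset.sum_congr rfl fun f _ => Finset.sum_congr rfl fun σ _ => ?_
  simp only [Matrix.submatrix_apply, id, prod_mul_distrib]
  ring

/-- The **Cauchy–Binet formula** for `M * Mᵀ`, summed over all maps `ι → Ω` instead of over the
subsets of `Ω`, so that every subset is counted once for each of its enumerations. -/
theorem sum_det_submatrix_sq (M : Matrix ι Ω R) :
    ∑ f : ι → Ω, (M.submatrix id f).det ^ 2 =
      (Fintype.card ι).factorial * (M * M.transpose).det := by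
  -- composing with a permutation of `ι` reindexes the sum over `f`
  have key : ∀ τ : Perm ι, ∑ f : ι → Ω, (∏ i, M i (f i)) * (M.submatrix id f).det =
      ∑ f : ι → Ω, (Perm.sign τ : R) * (∏ i, M (τ i) (f i)) * (M.submatrix id f).det := by
    intro τ
    rw [← (Equiv.arrowCongr τ (Equiv.refl Ω)).sum_comp]
    refine Finset.sum_congr rfl fun f _ => ?_
    have h1 : (M.submatrix id (Equiv.arrowCongr τ (Equiv.refl Ω) f)).det =
        (Perm.sign τ : R) * (M.submatrix id f).det := by
      have := Matrix.det_permute' τ⁻¹ (M.submatrix id f)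
      rw [Perm.sign_inv] at this
      rw [← this]
      rfl
    rw [h1, ← Equiv.prod_comp τ]
    simp only [Equiv.arrowCongr_apply, Equiv.coe_refl, Function.comp, id, Equiv.symm_apply_apply]
    ring
  rw [det_mul_eq_sum_prod_mul_det]
  simp only [Matrix.transpose_apply]
  rw [← Fintype.card_perm, ← nsmul_eq_mul, ← Finset.card_univ, ← Finset.sum_const,
    Finset.sum_congr rfl fun τ _ => key τ, Finset.sum_comm]
  refine Finset.sum_congr rfl fun f _ => ?_
  rw [← Finset.sum_mul, sq]
  congr 1
  rw [Matrix.det_apply']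
  rfl

end CauchyBinet

section Incidence
open Finset

variable {Ω A B : Type*} [DecidableEq A] [DecidableEq B]

/-- Entry of the incidence matrix of the bipartite multigraph with vertex set `A ⊕ B` and with an
edge from `p o` to `q o` for every `o : Ω`. -/
def incidence (p : Ω → A) (q : Ω → B) : Matrix (A ⊕ B) Ω ℝ :=
  fun r o => Sum.elim (fun x => if p o = x then 1 else 0) (fun y => if q o = y then 1 else 0) r

/-- Incidence matrices of bipartite graphs are totally unimodular: either a column of a square
submatrix has at most one non-zero entry, and the determinant can be expanded along it, or every
column has one entry in the rows from `A` and one in the rows from `B`, and then these two groups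
of rows have the same sum. -/
theorem det_incidence_submatrix_mem (p : Ω → A) (q : Ω → B) :
    ∀ (k : ℕ) (r : Fin k → A ⊕ B) (c : Fin k → Ω),
      ((incidence p q).submatrix r c).det = 0 ∨ ((incidence p q).submatrix r c).det ^ 2 = 1 := by
  intro k
  induction k with
  | zero => intro r c; right; simp
  | succ k ih =>
    intro r c
    by_cases hr : Function.Injective r
    swap
    · left
      simp only [Function.Injective, not_forall] at hr
      obtain ⟨i, j, hij, hne⟩ := hr
      exact Matrix.det_zero_of_row_eq hne (by ext x; simp [hij])
    by_cases hcol : ∃ j i, ∀ i', i' ≠ i → incidence p q (r i') (c j) = 0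
    · obtain ⟨j, i, hi⟩ := hcol
      rw [Matrix.det_succ_column _ j, Finset.sum_eq_single i]
      · have hent : incidence p q (r i) (c j) = 0 ∨ incidence p q (r i) (c j) = 1 := by
          cases h : r i <;> simp only [incidence, Sum.elim_inl, Sum.elim_inr] <;> grind
        rw [Matrix.submatrix_submatrix, Matrix.submatrix_apply]
        rcases hent with h | h
        · left; rw [h]; ring
        · rcases ih (r ∘ i.succAbove) (c ∘ j.succAbove) with h' | h'
          · left; rw [h']; ring
          · right; rw [mul_pow, mul_pow, h', h, ← pow_mul, mul_comm _ 2, pow_mul]; norm_num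
      · intro i' _ hne
        rw [Matrix.submatrix_apply, hi i' hne]; ring
      · simp
    · -- every column has at least two non-zero entries, hence one in each group of rows
      left
      push Not at hcol
      have hA : ∀ j, ∃ i, r i = Sum.inl (p (c j)) := by
        intro j
        by_contra! hno
        have h0 := fun i => hcol j i
        obtain ⟨i₁, -, h1⟩ := h0 0
        obtain ⟨i₂, h12, h2⟩ := h0 i₁
        have hq : ∀ i, incidence p q (r i) (c j) ≠ 0 → r i = Sum.inr (q (c j)) := by
          intro i hi
          cases h : r i with
          | inl x => have := hno i; simp [incidence, h] at hi this; grind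
          | inr y => simp [incidence, h] at hi; rw [hi]
        exact h12 (hr ((hq _ h2).trans (hq _ h1).symm))
      have hB : ∀ j, ∃ i, r i = Sum.inr (q (c j)) := by
        intro j
        by_contra! hno
        have h0 := fun i => hcol j i
        obtain ⟨i₁, -, h1⟩ := h0 0
        obtain ⟨i₂, h12, h2⟩ := h0 i₁
        have hq : ∀ i, incidence p q (r i) (c j) ≠ 0 → r i = Sum.inl (p (c j)) := by
          intro i hi
          cases h : r i with
          | inr x => have := hno i; simp [incidence, h] at hi this; grind
          | inl y => simp [incidence, h] at hi; rw [hi]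
        exact h12 (hr ((hq _ h2).trans (hq _ h1).symm))
      let w : Fin (k + 1) → ℝ := fun i => Sum.elim (fun _ => 1) (fun _ => -1) (r i)
      refine Matrix.exists_vecMul_eq_zero_iff.mp ⟨w, ?_, ?_⟩
      · intro h
        have := congrFun h 0
        cases h0 : r 0 <;> simp [w, h0] at this
      · ext j
        obtain ⟨i₁, h1⟩ := hA j
        obtain ⟨i₂, h2⟩ := hB j
        have hne : i₁ ≠ i₂ := by rintro rfl; rw [h1] at h2; cases h2
        simp only [Matrix.vecMul, dotProduct, Matrix.submatrix_apply, Pi.zero_apply]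
        rw [← Finset.sum_subset (Finset.subset_univ {i₁, i₂}), Finset.sum_pair hne]
        · simp [w, h1, h2, incidence]
        · intro i _ hi
          simp only [Finset.mem_insert, Finset.mem_singleton, not_or] at hi
          have n1 : r i ≠ r i₁ := fun h => hi.1 (hr h)
          have n2 : r i ≠ r i₂ := fun h => hi.2 (hr h)
          rw [h1] at n1
          rw [h2] at n2
          cases h : r i <;> simp [incidence, h] at n1 n2 ⊢ <;> grind

end Incidence

/-! ### Counting bases among the columns of a matrix -/

section Bases
open Finset

/-- In a spanning family, the maximal independent sets of indices are those of full size. -/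
theorem maximal_linearIndepOn_iff {K V Ω : Type*} [Field K] [AddCommGroup V] [Module K V]
    [FiniteDimensional K V] [Finite Ω] {v : Ω → V} (hv : Submodule.span K (Set.range v) = ⊤)
    (T : Set Ω) :
    Maximal (LinearIndepOn K v) T ↔ LinearIndepOn K v T ∧ T.ncard = Module.finrank K V := by
  classical
  have := Fintype.ofFinite Ω
  constructor
  · intro hT
    have hE := hT.prop.linearIndepOn_extend (Set.subset_univ T)
    have hTE : T = hT.prop.extend (Set.subset_univ T) :=
      hT.eq_of_subset hE (hT.prop.subset_extend _)
    have hspan := hT.prop.span_image_extend_eq_span_image (Set.subset_univ T)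
    rw [← hTE, Set.image_univ, hv] at hspan
    refine ⟨hT.prop, ?_⟩
    have h := finrank_span_eq_card hT.prop.linearIndependent
    have hr : Set.range (fun x : T => v x) = v '' T := by
      rw [Set.image_eq_range]
    rw [hr, hspan, finrank_top] at h
    rw [h, ← Nat.card_coe_set_eq, Nat.card_eq_fintype_card]
  · rintro ⟨hT, hc⟩
    refine ⟨hT, fun S hS hTS => ?_⟩
    have h := hS.linearIndependent.fintype_card_le_finrank
    rw [← hc, ← Nat.card_eq_fintype_card, Nat.card_coe_set_eq] at h
    exact (Set.eq_of_subset_of_ncard_le hTS h).ge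

variable {ι Ω : Type*} [Fintype ι] [DecidableEq ι]

theorem det_submatrix_ne_zero_iff (M : Matrix ι Ω ℝ) (f : ι → Ω) :
    (M.submatrix id f).det ≠ 0 ↔ f.Injective ∧ LinearIndepOn ℝ M.col (Set.range f) := by
  rw [← isUnit_iff_ne_zero, ← Matrix.isUnit_iff_isUnit_det,
    ← Matrix.linearIndependent_cols_iff_isUnit]
  change LinearIndependent ℝ (M.col ∘ f) ↔ _
  constructor
  · intro h
    have hf : f.Injective := h.injective.of_comp
    exact ⟨hf, (linearIndepOn_range_iff hf _).mpr h⟩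
  · rintro ⟨hf, h⟩
    exact (linearIndepOn_range_iff hf _).mp h

/-- When every maximal minor of `M` is `0` or `±1`, the Cauchy–Binet formula counts the bases that
can be chosen among the columns of `M`. -/
theorem ncard_maximal_linearIndepOn_col [Fintype Ω] (M : Matrix ι Ω ℝ)
    (hspan : Submodule.span ℝ (Set.range M.col) = ⊤)
    (hdet : ∀ f : ι → Ω, (M.submatrix id f).det = 0 ∨ (M.submatrix id f).det ^ 2 = 1) :
    (({T | Maximal (LinearIndepOn ℝ M.col) T} : Set (Set Ω)).ncard : ℝ) =
      (M * M.transpose).det := by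
  classical
  set 𝓑 : Set (Set Ω) := {T | Maximal (LinearIndepOn ℝ M.col) T} with h𝓑
  have hmem : ∀ T, T ∈ 𝓑 ↔ LinearIndepOn ℝ M.col T ∧ T.ncard = Fintype.card ι := by
    intro T
    rw [h𝓑, Set.mem_ofPred_eq, maximal_linearIndepOn_iff hspan, Module.finrank_fintype_fun_eq_card]
  -- the maps with non-zero minor are the enumerations of bases, and a basis has `|ι|!` of them
  have hF : Fintype.card {f : ι → Ω // (M.submatrix id f).det ≠ 0} =
      𝓑.ncard * (Fintype.card ι).factorial := by
    let g : (Σ T : 𝓑, ι ≃ T.1) → {f : ι → Ω // (M.submatrix id f).det ≠ 0} := fun x =>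
      ⟨fun i => (x.2 i).1, by
        rw [det_submatrix_ne_zero_iff]
        have hr : Set.range (fun i => (x.2 i).1) = x.1.1 := by
          ext o
          constructor
          · rintro ⟨i, rfl⟩; exact (x.2 i).2
          · intro ho; exact ⟨x.2.symm ⟨o, ho⟩, by simp⟩
        refine ⟨fun i j hij => x.2.injective (Subtype.ext hij), ?_⟩
        rw [hr]
        exact ((hmem _).mp x.1.2).1⟩
    have hg : g.Bijective := by
      constructor
      · rintro ⟨⟨T, hT⟩, e⟩ ⟨⟨T', hT'⟩, e'⟩ h
        have hfun : ∀ i, (e i).1 = (e' i).1 := fun i => congrFun (congrArg Subtype.val h) i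
        have hTT : T = T' := by
          ext o
          constructor
          · intro ho
            have := hfun (e.symm ⟨o, ho⟩)
            simp only [Equiv.apply_symm_apply] at this
            rw [this]; exact (e' _).2
          · intro ho
            have := hfun (e'.symm ⟨o, ho⟩)
            simp only [Equiv.apply_symm_apply] at this
            rw [← this]; exact (e _).2
        subst hTT
        congr 1
        ext i
        exact hfun i
      · rintro ⟨f, hf⟩
        obtain ⟨hinj, hli⟩ := (det_submatrix_ne_zero_iff M f).mp hf
        refine ⟨⟨⟨Set.range f, (hmem _).mpr ⟨hli, ?_⟩⟩, Equiv.ofInjective f hinj⟩, rfl⟩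
        rw [← Set.image_univ, Set.ncard_image_of_injective _ hinj, Set.ncard_univ,
          Nat.card_eq_fintype_card]
    rw [← Nat.card_eq_fintype_card, ← Nat.card_congr (Equiv.ofBijective g hg), Nat.card_sigma]
    have hc : ∀ T : 𝓑, Nat.card (ι ≃ T.1) = (Fintype.card ι).factorial := by
      intro T
      have h := ((hmem _).mp T.2).2
      rw [← Nat.card_coe_set_eq, ← Nat.card_eq_fintype_card] at h
      obtain ⟨e⟩ := Finite.card_eq.mp h.symm
      rw [Nat.card_eq_fintype_card, Fintype.card_equiv e]
    rw [Finset.sum_congr rfl fun T _ => hc T, Finset.sum_const, Finset.card_univ, smul_eq_mul,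
      ← Nat.card_eq_fintype_card, Nat.card_coe_set_eq]
  have hsum : ∑ f : ι → Ω, (M.submatrix id f).det ^ 2 =
      (Fintype.card {f : ι → Ω // (M.submatrix id f).det ≠ 0} : ℝ) := by
    rw [Fintype.card_subtype, Finset.card_filter, Nat.cast_sum]
    refine Finset.sum_congr rfl fun f _ => ?_
    rcases hdet f with h | h
    · simp [h]
    · have : (M.submatrix id f).det ≠ 0 := by rintro h0; simp [h0] at h
      simp [h, this]
  have hpos : ((Fintype.card ι).factorial : ℝ) ≠ 0 := by positivity
  have h := sum_det_submatrix_sq M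
  rw [hsum, hF] at h
  push_cast at h
  exact mul_left_cancel₀ hpos (by rw [← h]; ring)

end Bases

/-! ### Spanning trees of complete bipartite multigraphs -/

section SpanningForests
open Finset

variable {Ω A B : Type*}

/-- Every real function on the set `T` of edges of the bipartite multigraph with end point maps
`p : Ω → A` and `q : Ω → B` is the sum of a function of the first and a function of the second
end point; equivalently, `T` is a forest. -/
def Splits (p : Ω → A) (q : Ω → B) (T : Set Ω) : Prop :=
  ∀ f : Ω → ℝ, ∃ (u : A → ℝ) (v : B → ℝ), ∀ o ∈ T, f o = u (p o) + v (q o)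

variable [DecidableEq A] [DecidableEq B]

/-- The incidence matrix with the row of the vertex `b₀ : B` removed. -/
def reducedIncidence (p : Ω → A) (q : Ω → B) (b₀ : B) : Matrix (A ⊕ {b // b ≠ b₀}) Ω ℝ :=
  (incidence p q).submatrix (Sum.map id Subtype.val) id

theorem card_left_fibre [Fintype Ω] [Fintype B] {p : Ω → A} {q : Ω → B} {a : ℕ}
    (hfib : ∀ x y, #{o | p o = x ∧ q o = y} = a) (x : A) :
    #{o | p o = x} = a * Fintype.card B := by
  rw [Finset.card_eq_sum_card_fiberwise (f := q) (t := univ) fun _ _ => by simp]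
  simp [Finset.filter_filter, hfib, mul_comm]

theorem card_right_fibre [Fintype Ω] [Fintype A] {p : Ω → A} {q : Ω → B} {a : ℕ}
    (hfib : ∀ x y, #{o | p o = x ∧ q o = y} = a) (y : B) :
    #{o | q o = y} = a * Fintype.card A := by
  rw [Finset.card_eq_sum_card_fiberwise (f := p) (t := univ) fun _ _ => by simp]
  simp [Finset.filter_filter, and_comm, hfib, mul_comm]

variable [Fintype A] [Fintype B]

theorem sum_mul_reducedIncidence (p : Ω → A) (q : Ω → B) (b₀ : B)
    (w : A ⊕ {b // b ≠ b₀} → ℝ) (o : Ω) :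
    ∑ i, w i * reducedIncidence p q b₀ i o =
      w (Sum.inl (p o)) + (if h : q o ≠ b₀ then w (Sum.inr ⟨q o, h⟩) else 0) := by
  rw [Fintype.sum_sum_type]
  congr 1
  · simp [reducedIncidence, incidence]
  · simp only [reducedIncidence, incidence, Matrix.submatrix_apply, Sum.map_inr, Sum.elim_inr,
      id, mul_ite, mul_one, mul_zero]
    split_ifs with h
    · rw [Finset.sum_eq_single ⟨q o, h⟩]
      · simp
      · intro b _ hb
        rw [if_neg]
        exact fun hq => hb (Subtype.ext hq.symm)
      · simp
    · refine Finset.sum_eq_zero fun b _ => if_neg ?_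
      exact fun hq => h (hq ▸ b.2)

theorem apply_reducedIncidence_col (p : Ω → A) (q : Ω → B) (b₀ : B)
    (L : (A ⊕ {b // b ≠ b₀} → ℝ) →ₗ[ℝ] ℝ) (o : Ω) :
    L ((reducedIncidence p q b₀).col o) = L (Pi.single (Sum.inl (p o)) 1) +
      (if h : q o ≠ b₀ then L (Pi.single (Sum.inr ⟨q o, h⟩) 1) else 0) := by
  rw [← sum_mul_reducedIncidence p q b₀ (fun i => L (Pi.single i 1)) o]
  refine (LinearMap.pi_apply_eq_sum_univ L _).trans (Finset.sum_congr rfl fun i _ => ?_)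
  have hs : (fun j => if i = j then (1 : ℝ) else 0) = Pi.single i 1 := by
    ext j
    simp [Pi.single_apply, eq_comm]
  rw [smul_eq_mul, mul_comm, hs]
  rfl

/-- If the columns are dependent, a relation between them is orthogonal to all functions
`u (p o) + v (q o)` on `T`, hence is not of this form. If they are independent, a linear form with
prescribed values on them provides `u` and `v`. -/
theorem splits_iff_linearIndepOn [Finite Ω] (p : Ω → A) (q : Ω → B) (b₀ : B) (T : Set Ω) :
    Splits p q T ↔ LinearIndepOn ℝ (reducedIncidence p q b₀).col T := by
  classical
  have := Fintype.ofFinite Ω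
  set M := reducedIncidence p q b₀ with hM
  constructor
  · intro hT
    rw [linearIndepOn_iff']
    intro t c htT hc
    obtain ⟨u, v, huv⟩ := hT c
    have hrow : ∀ i, ∑ o ∈ t, c o * M i o = 0 := fun i => by
      simpa [Matrix.col, Finset.sum_apply] using congrFun hc i
    -- constants can be shifted from `v` to `u` so that `v b₀ = 0`
    let w : A ⊕ {b // b ≠ b₀} → ℝ := Sum.elim (fun x => u x + v b₀) (fun y => v y - v b₀)
    have hw : ∀ o ∈ t, ∑ i, w i * M i o = c o := by
      intro o ho
      rw [hM, sum_mul_reducedIncidence, huv o (htT ho)]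
      by_cases h : q o = b₀ <;> simp [w, h]
    have hsq : ∑ o ∈ t, c o * c o = 0 := by
      calc ∑ o ∈ t, c o * c o = ∑ o ∈ t, c o * ∑ i, w i * M i o :=
            Finset.sum_congr rfl fun o ho => by rw [hw o ho]
        _ = ∑ i, w i * ∑ o ∈ t, c o * M i o := by
            simp only [Finset.mul_sum]
            rw [Finset.sum_comm]
            exact Finset.sum_congr rfl fun _ _ => Finset.sum_congr rfl fun _ _ => by ring
        _ = 0 := by simp [hrow]
    intro o ho
    exact mul_self_eq_zero.mp
      ((Finset.sum_eq_zero_iff_of_nonneg fun o _ => mul_self_nonneg (c o)).mp hsq o ho)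
  · intro hT f
    -- a linear form with prescribed values on the independent columns
    obtain ⟨L, hL⟩ : ∃ L : (A ⊕ {b // b ≠ b₀} → ℝ) →ₗ[ℝ] ℝ, ∀ o ∈ T, L (M.col o) = f o := by
      have hli := hT.linearIndependent
      obtain ⟨L, hL⟩ := ((Module.Basis.span hli).constr ℝ fun o : T => f o).exists_extend
      refine ⟨L, fun o ho => ?_⟩
      have h1 := (Module.Basis.span hli).constr_basis ℝ (fun o : T => f o) ⟨o, ho⟩
      rw [← hL, LinearMap.comp_apply] at h1
      rw [← h1]
      congr 1
      rw [Module.Basis.span_apply hli ⟨o, ho⟩]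
      rfl
    refine ⟨fun x => L (Pi.single (Sum.inl x) 1),
      fun y => if h : y ≠ b₀ then L (Pi.single (Sum.inr ⟨y, h⟩) 1) else 0, fun o ho => ?_⟩
    rw [← hL o ho, hM, apply_reducedIncidence_col]

theorem span_reducedIncidence_col [Nonempty A] {p : Ω → A} {q : Ω → B}
    (hsurj : ∀ x y, ∃ o, p o = x ∧ q o = y) (b₀ : B) :
    Submodule.span ℝ (Set.range (reducedIncidence p q b₀).col) = ⊤ := by
  by_contra hne
  obtain ⟨L, hL0, hL⟩ := Submodule.exists_le_ker_of_lt_top _ (lt_top_iff_ne_top.mpr hne)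
  apply hL0
  have hval : ∀ o, L (Pi.single (Sum.inl (p o)) 1) +
      (if h : q o ≠ b₀ then L (Pi.single (Sum.inr ⟨q o, h⟩) 1) else 0) = 0 := fun o => by
    rw [← apply_reducedIncidence_col]
    exact hL (Submodule.subset_span ⟨o, rfl⟩)
  have hA : ∀ x, L (Pi.single (Sum.inl x) 1) = 0 := by
    intro x
    obtain ⟨o, rfl, h⟩ := hsurj x b₀
    simpa [h] using hval o
  refine LinearMap.pi_ext' fun i => LinearMap.ext_ring ?_
  rcases i with x | ⟨y, hy⟩
  · simpa using hA x
  · obtain ⟨o, -, rfl⟩ := hsurj (Classical.arbitrary A) y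
    simpa [hA, hy] using hval o

variable [Fintype Ω]

theorem reducedIncidence_mul_transpose {p : Ω → A} {q : Ω → B} {a : ℕ}
    (hfib : ∀ x y, #{o | p o = x ∧ q o = y} = a) (b₀ : B) :
    reducedIncidence p q b₀ * (reducedIncidence p q b₀).transpose =
      Matrix.fromBlocks ((a * Fintype.card B : ℝ) • 1) (Matrix.of fun _ _ => (a : ℝ))
        (Matrix.of fun _ _ => (a : ℝ)) ((a * Fintype.card A : ℝ) • 1) := by
  have hind : ∀ (P Q : Ω → Prop) [DecidablePred P] [DecidablePred Q],
      ∑ o, (if P o then (1 : ℝ) else 0) * (if Q o then 1 else 0) = #{o | P o ∧ Q o} := by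
    intro P Q _ _
    simp only [ite_mul, one_mul, zero_mul, ← ite_and]
    rw [Finset.sum_boole]
  ext (x | ⟨y, hy⟩) (x' | ⟨y', hy'⟩)
  · simp only [Matrix.mul_apply, Matrix.transpose_apply, reducedIncidence, incidence,
      Matrix.submatrix_apply, Sum.map_inl, Sum.elim_inl, id, Matrix.fromBlocks_apply₁₁]
    rw [hind]
    rcases eq_or_ne x x' with rfl | h
    · simp [card_left_fibre hfib]
    · have : #{o | p o = x ∧ p o = x'} = 0 := by
        rw [Finset.card_eq_zero, Finset.filter_eq_empty_iff]
        rintro o - ⟨h1, h2⟩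
        exact h (h1.symm.trans h2)
      simp [this, h]
  · simp only [Matrix.mul_apply, Matrix.transpose_apply, reducedIncidence, incidence,
      Matrix.submatrix_apply, Sum.map_inl, Sum.elim_inl, Sum.map_inr, Sum.elim_inr, id,
      Matrix.fromBlocks_apply₁₂]
    rw [hind, hfib, Matrix.of_apply]
  · simp only [Matrix.mul_apply, Matrix.transpose_apply, reducedIncidence, incidence,
      Matrix.submatrix_apply, Sum.map_inl, Sum.elim_inl, Sum.map_inr, Sum.elim_inr, id,
      Matrix.fromBlocks_apply₂₁]
    simp_rw [hind, and_comm (a := q _ = y)]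
    rw [hfib, Matrix.of_apply]
  · simp only [Matrix.mul_apply, Matrix.transpose_apply, reducedIncidence, incidence,
      Matrix.submatrix_apply, Sum.map_inr, Sum.elim_inr, Matrix.fromBlocks_apply₂₂]
    rw [hind]
    rcases eq_or_ne y y' with rfl | h
    · simp [card_right_fibre hfib]
    · have : #{o | q o = y ∧ q o = y'} = 0 := by
        rw [Finset.card_eq_zero, Finset.filter_eq_empty_iff]
        rintro o - ⟨h1, h2⟩
        exact h (h1.symm.trans h2)
      simp [this, h]

/-- By the Schur complement, this reduces to the determinant of a rank one perturbation of the
identity. -/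
theorem det_fromBlocks_const {ι κ : Type*} [Fintype ι] [Fintype κ] [DecidableEq ι] [DecidableEq κ]
    {α β a : ℝ} (hα : α ≠ 0) (hβ : β ≠ 0) :
    (Matrix.fromBlocks (α • (1 : Matrix ι ι ℝ)) (Matrix.of fun _ _ => a)
      (Matrix.of fun _ _ => a) (β • (1 : Matrix κ κ ℝ))).det =
      α ^ Fintype.card ι * β ^ Fintype.card κ *
        (1 - a ^ 2 * Fintype.card ι * Fintype.card κ / (α * β)) := by
  let _ : Invertible (α • (1 : Matrix ι ι ℝ)) :=
    ⟨α⁻¹ • 1, by simp [smul_smul, hα], by simp [smul_smul, hα]⟩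
  have hinv : ⅟(α • (1 : Matrix ι ι ℝ)) = α⁻¹ • 1 := rfl
  have hS : (β • (1 : Matrix κ κ ℝ)) - (Matrix.of fun (_ : κ) (_ : ι) => a) *
      ⅟(α • (1 : Matrix ι ι ℝ)) * (Matrix.of fun (_ : ι) (_ : κ) => a) =
      β • (1 + Matrix.replicateCol Unit (fun _ : κ => -(a ^ 2 * Fintype.card ι / (α * β))) *
        Matrix.replicateRow Unit (fun _ : κ => (1 : ℝ))) := by
    rw [hinv]
    ext i j
    simp [Matrix.mul_apply]
    field_simp
    ring
  rw [Matrix.det_fromBlocks₁₁, hS, Matrix.det_smul, Matrix.det_smul, Matrix.det_one,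
    Matrix.det_one_add_replicateCol_mul_replicateRow]
  simp only [dotProduct, one_mul, Finset.sum_const, Finset.card_univ, nsmul_eq_mul]
  ring

/-- The number of spanning trees of the bipartite multigraph on `A ⊕ B` that joins every vertex of
`A` to every vertex of `B` by exactly `a` edges. -/
theorem ncard_maximal_splits [Nonempty A] [Nonempty B] {p : Ω → A} {q : Ω → B} {a : ℕ}
    (ha : a ≠ 0) (hfib : ∀ x y, #{o | p o = x ∧ q o = y} = a) :
    ({T | Maximal (Splits p q) T} : Set (Set Ω)).ncard =
      a ^ (Fintype.card A + Fintype.card B - 1) * Fintype.card A ^ (Fintype.card B - 1) *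
        Fintype.card B ^ (Fintype.card A - 1) := by
  obtain ⟨b₀⟩ := ‹Nonempty B›
  have hsurj : ∀ x y, ∃ o, p o = x ∧ q o = y := by
    intro x y
    have h : (univ.filter fun o => p o = x ∧ q o = y).Nonempty := by
      rw [← Finset.card_ne_zero, hfib]; exact ha
    obtain ⟨o, ho⟩ := h
    exact ⟨o, by simpa using ho⟩
  have hdet : ∀ f : (A ⊕ {b // b ≠ b₀}) → Ω, ((reducedIncidence p q b₀).submatrix id f).det = 0 ∨
      ((reducedIncidence p q b₀).submatrix id f).det ^ 2 = 1 := by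
    intro f
    let e := (Fintype.equivFin (A ⊕ {b // b ≠ b₀})).symm
    have := det_incidence_submatrix_mem p q _ (Sum.map id Subtype.val ∘ e) (f ∘ e)
    rw [← Matrix.det_submatrix_equiv_self e]
    exact this
  have hset : ({T | Maximal (Splits p q) T} : Set (Set Ω)) =
      {T | Maximal (LinearIndepOn ℝ (reducedIncidence p q b₀).col) T} := by
    have : Splits p q = LinearIndepOn ℝ (reducedIncidence p q b₀).col := by
      ext T; exact splits_iff_linearIndepOn p q b₀ T
    rw [this]
  have h := ncard_maximal_linearIndepOn_col _ (span_reducedIncidence_col hsurj b₀) hdet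
  have hcB : Fintype.card {b // b ≠ b₀} = Fintype.card B - 1 := by
    rw [Fintype.card_subtype_compl, Fintype.card_subtype_eq]
  have hA0 : Fintype.card A ≠ 0 := Fintype.card_ne_zero
  have hB0 : Fintype.card B ≠ 0 := Fintype.card_ne_zero
  rw [← hset, reducedIncidence_mul_transpose hfib, det_fromBlocks_const (by positivity)
    (by positivity), hcB] at h
  obtain ⟨m, hm⟩ := Nat.exists_eq_succ_of_ne_zero hA0
  obtain ⟨n, hn⟩ := Nat.exists_eq_succ_of_ne_zero hB0
  rw [hm, hn] at h ⊢
  rw [← Nat.cast_inj (R := ℝ), h]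
  rw [show m.succ + n.succ - 1 = m.succ + n by omega]
  simp only [Nat.succ_eq_add_one, Nat.add_sub_cancel]
  push_cast
  have ha' : (a : ℝ) ≠ 0 := by exact_mod_cast ha
  rw [mul_pow, mul_pow, pow_add (a : ℝ) (m + 1) n, pow_succ (n + 1 : ℝ)]
  field_simp
  ring

end SpanningForests

/-! ### Extreme couplings -/

namespace FixedMarginals

section ExtremePoints

variable {G X Y : Type*} [Group G] [MulAction G X] [MulAction G Y]

theorem IsGood.exists_maximal [Finite X] [Finite Y] {S : Set (X × Y)} (hS : IsGood G S) :
    ∃ T, S ⊆ T ∧ Maximal (IsGood G) T :=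
  (Set.toFinite {T : Set (X × Y) | IsGood G T}).exists_le_maximal hS

theorem isInvariantFun_sum_fst [Fintype Y] {ν : X × Y → ℝ} (hν : IsInvariantFun G ν) :
    IsInvariantFun G fun x => ∑ y, ν (x, y) := by
  intro g x
  refine (Equiv.sum_comp (MulAction.toPerm g) fun y => ν (g • x, y)).symm.trans ?_
  exact Finset.sum_congr rfl fun y _ => hν g (x, y)

theorem isInvariantFun_sum_snd [Fintype X] {ν : X × Y → ℝ} (hν : IsInvariantFun G ν) :
    IsInvariantFun G fun y => ∑ x, ν (x, y) := by
  intro g y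
  refine (Equiv.sum_comp (MulAction.toPerm g) fun x => ν (x, g • y)).symm.trans ?_
  exact Finset.sum_congr rfl fun x _ => hν g (x, y)

variable [Fintype X] [Fintype Y]

theorem sum_mul_add_eq (ν : X × Y → ℝ) (u : X → ℝ) (v : Y → ℝ) :
    ∑ p, ν p * (u p.1 + v p.2) = ∑ x, (∑ y, ν (x, y)) * u x + ∑ y, (∑ x, ν (x, y)) * v y := by
  simp only [mul_add, Finset.sum_add_distrib, Finset.sum_mul]
  rw [Fintype.sum_prod_type, Fintype.sum_prod_type_right]

/-- A coupling is determined by its marginals among those carried by a given good set: the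
difference of two such couplings is orthogonal to all functions `u(x) + v(y)`, and on a good set
it is itself such a function. -/
theorem IsGood.eq_of_couplings {S : Set (X × Y)} (hS : IsGood G S) {μ₁ : X → ℝ} {μ₂ : Y → ℝ}
    {μ ν : X × Y → ℝ} (hμ : μ ∈ couplings G μ₁ μ₂) (hν : ν ∈ couplings G μ₁ μ₂)
    (hμS : ∀ p ∉ S, μ p = 0) (hνS : ∀ p ∉ S, ν p = 0) : μ = ν := by
  obtain ⟨u, v, -, -, huv⟩ := hS.2 (fun p => μ p - ν p)
    fun g p _ => by simp only [hμ.1.2 g p, hν.1.2 g p]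
  have h := sum_mul_add_eq (fun p => μ p - ν p) u v
  simp only [Finset.sum_sub_distrib, hμ.2.1, hμ.2.2, hν.2.1, hν.2.2, sub_self, zero_mul,
    Finset.sum_const_zero, add_zero] at h
  have hsq : ∑ p, (μ p - ν p) * (μ p - ν p) = 0 := by
    rw [← h]
    refine Finset.sum_congr rfl fun p _ => ?_
    by_cases hp : p ∈ S
    · rw [← huv p hp]
    · simp [hμS p hp, hνS p hp]
  ext p
  exact sub_eq_zero.mp (mul_self_eq_zero.mp
    ((Finset.sum_eq_zero_iff_of_nonneg fun p _ => mul_self_nonneg _).mp hsq p (Finset.mem_univ p)))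

/-- On an invariant set that is not good there is a non-zero invariant signed measure with zero
marginals: the component, orthogonal to the functions `u(x) + v(y)`, of an invariant function
that is not of this form. -/
theorem exists_zero_marginals_of_not_isGood {S : Set (X × Y)}
    (hinv : ∀ (g : G), ∀ p ∈ S, g • p ∈ S) (hS : ¬ IsGood G S) :
    ∃ ν : X × Y → ℝ, ν ≠ 0 ∧ IsInvariantFun G ν ∧ (∀ p ∉ S, ν p = 0) ∧
      (∀ x, ∑ y, ν (x, y) = 0) ∧ ∀ y, ∑ x, ν (x, y) = 0 := by
  classical
  have hmem : ∀ (g : G) p, g • p ∈ S ↔ p ∈ S := fun g p =>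
    ⟨fun h => by simpa using hinv g⁻¹ _ h, hinv g p⟩
  simp only [IsGood, not_and, not_forall, not_exists] at hS
  obtain ⟨f, hf, hno⟩ := hS hinv
  let W : Submodule ℝ (EuclideanSpace ℝ (X × Y)) :=
    { carrier := {h | ∃ u v, IsInvariantFun G u ∧ IsInvariantFun G v ∧
        ∀ p : X × Y, h p = if p ∈ S then u p.1 + v p.2 else 0}
      zero_mem' := ⟨0, 0, fun _ _ => rfl, fun _ _ => rfl, fun p => by simp⟩
      add_mem' := by
        rintro h h' ⟨u, v, hu, hv, e⟩ ⟨u', v', hu', hv', e'⟩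
        refine ⟨u + u', v + v', fun g x => by simp [hu g x, hu' g x],
          fun g y => by simp [hv g y, hv' g y], fun p => ?_⟩
        rw [PiLp.add_apply, e, e']
        split_ifs
        · simp only [Pi.add_apply]; ring
        · simp
      smul_mem' := by
        rintro c h ⟨u, v, hu, hv, e⟩
        refine ⟨c • u, c • v, fun g x => by simp [hu g x], fun g y => by simp [hv g y],
          fun p => ?_⟩
        rw [PiLp.smul_apply, e]
        split_ifs
        · simp only [Pi.smul_apply, smul_eq_mul]; ring
        · simp }
  obtain ⟨w, hw, z, hz, hwz⟩ := W.exists_add_mem_mem_orthogonal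
    (WithLp.toLp 2 fun p => if p ∈ S then f p else 0)
  obtain ⟨u, v, hu, hv, huv⟩ := hw
  have hz' : ∀ p, z p = if p ∈ S then f p - (u p.1 + v p.2) else 0 := by
    intro p
    have := congrArg (fun t : EuclideanSpace ℝ (X × Y) => t p) hwz
    simp only [PiLp.add_apply, huv] at this
    split_ifs at this ⊢ <;> linarith
  have hzinv : IsInvariantFun G z.ofLp := by
    intro g p
    rw [hz', hz']
    by_cases hp : p ∈ S
    · rw [if_pos hp, if_pos (hinv g p hp), hf g p hp, Prod.smul_fst, Prod.smul_snd, hu, hv]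
    · rw [if_neg hp, if_neg fun h => hp ((hmem g p).mp h)]
  have hzS : ∀ p ∉ S, z p = 0 := fun p hp => by rw [hz', if_neg hp]
  have horth : ∀ u v, IsInvariantFun G u → IsInvariantFun G v →
      ∑ p : X × Y, z p * (u p.1 + v p.2) = 0 := by
    intro u v hu hv
    have := (Submodule.mem_orthogonal W z).mp hz
      (WithLp.toLp 2 fun p => if p ∈ S then u p.1 + v p.2 else 0) ⟨u, v, hu, hv, fun p => rfl⟩
    rw [PiLp.inner_apply] at this
    rw [← this]
    refine Finset.sum_congr rfl fun p _ => ?_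
    by_cases hp : p ∈ S
    · simp [hp]
    · simp [hp, hzS p hp]
  refine ⟨z.ofLp, ?_, hzinv, hzS, ?_, ?_⟩
  · intro h0
    obtain ⟨p, hp, hne⟩ := hno u v hu hv
    apply hne
    have := congrFun h0 p
    rw [hz', if_pos hp, Pi.zero_apply] at this
    linarith
  · have h := horth (fun x => ∑ y, z (x, y)) 0 (isInvariantFun_sum_fst hzinv) fun _ _ => rfl
    rw [sum_mul_add_eq z.ofLp (fun x => ∑ y, z (x, y)) 0] at h
    simp only [Pi.zero_apply, mul_zero, Finset.sum_const_zero, add_zero] at h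
    exact fun x => mul_self_eq_zero.mp ((Finset.sum_eq_zero_iff_of_nonneg
      fun _ _ => mul_self_nonneg _).mp h x (Finset.mem_univ x))
  · have h := horth 0 (fun y => ∑ x, z (x, y)) (fun _ _ => rfl) (isInvariantFun_sum_snd hzinv)
    rw [sum_mul_add_eq z.ofLp 0 (fun y => ∑ x, z (x, y))] at h
    simp only [Pi.zero_apply, mul_zero, Finset.sum_const_zero, zero_add] at h
    exact fun y => mul_self_eq_zero.mp ((Finset.sum_eq_zero_iff_of_nonneg
      fun _ _ => mul_self_nonneg _).mp h y (Finset.mem_univ y))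

/-- An extreme coupling has a good support, since otherwise it is the midpoint of two couplings that
differ by a signed measure with zero marginals. -/
theorem isGood_support_of_mem_extremeCouplings {μ₁ : X → ℝ} {μ₂ : Y → ℝ} {μ : X × Y → ℝ}
    (hμ : μ ∈ extremeCouplings G μ₁ μ₂) : IsGood G {p | μ p ≠ 0} := by
  obtain ⟨hμc, hext⟩ := mem_extremePoints.mp hμ
  obtain ⟨⟨⟨hnn, hsum⟩, hinv⟩, hm1, hm2⟩ := hμc
  by_contra hbad
  obtain ⟨ν, hν0, hνinv, hνS, hν1, hν2⟩ := exists_zero_marginals_of_not_isGood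
    (fun g p (hp : μ p ≠ 0) => show μ (g • p) ≠ 0 by rwa [hinv g p]) hbad
  -- a small multiple of `ν` can be added to `μ` and subtracted from it
  obtain ⟨ε, hε, hεν⟩ : ∃ ε : ℝ, 0 < ε ∧ ∀ p, ε * |ν p| ≤ μ p := by
    have hev : ∀ᶠ ε : ℝ in 𝓝[>] 0, ∀ p, ε * |ν p| ≤ μ p := by
      rw [eventually_all]
      intro p
      by_cases hp : μ p = 0
      · have : ν p = 0 := hνS p fun h => h hp
        simp [hp, this]
      · have hpos : 0 < μ p := lt_of_le_of_ne (hnn p) (Ne.symm hp)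
        have ht : Tendsto (fun ε : ℝ => ε * |ν p|) (𝓝[>] 0) (𝓝 (0 * |ν p|)) :=
          (tendsto_nhdsWithin_of_tendsto_nhds tendsto_id).mul_const _
        rw [zero_mul] at ht
        exact (ht.eventually_lt_const hpos).mono fun _ h => h.le
    obtain ⟨ε, h1, h2⟩ := (hev.and self_mem_nhdsWithin).exists
    exact ⟨ε, h2, h1⟩
  have hmem : ∀ c : ℝ, |c| = ε → μ + c • ν ∈ couplings G μ₁ μ₂ := by
    intro c hc
    refine ⟨⟨⟨fun p => ?_, ?_⟩, fun g p => ?_⟩, fun x => ?_, fun y => ?_⟩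
    · have h1 := hεν p
      rw [← hc, ← abs_mul] at h1
      have := neg_abs_le (c * ν p)
      simp only [Pi.add_apply, Pi.smul_apply, smul_eq_mul]
      linarith
    · have : ∑ p, ν p = 0 := by rw [Fintype.sum_prod_type]; simp [hν1]
      simp [Finset.sum_add_distrib, ← Finset.mul_sum, hsum, this]
    · simp [hinv g p, hνinv g p]
    · simp [Finset.sum_add_distrib, ← Finset.mul_sum, hm1, hν1]
    · simp [Finset.sum_add_distrib, ← Finset.mul_sum, hm2, hν2]
  have heq := (hext _ (hmem ε (abs_of_pos hε)) _ (hmem (-ε) (by rw [abs_neg, abs_of_pos hε]))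
    ⟨1 / 2, 1 / 2, by norm_num, by norm_num, by norm_num, by ext p; simp; ring⟩).1
  exact hν0 (by simpa [hε.ne'] using heq)

theorem extremeCouplings_finite_and_ncard_le (μ₁ : X → ℝ) (μ₂ : Y → ℝ) :
    (extremeCouplings G μ₁ μ₂).Finite ∧
      (extremeCouplings G μ₁ μ₂).ncard ≤ numMaximalGood G X Y := by
  have hex : ∀ μ ∈ extremeCouplings G μ₁ μ₂, ∃ T : Set (X × Y),
      Maximal (IsGood G) T ∧ ∀ p ∉ T, μ p = 0 := by
    intro μ hμ
    obtain ⟨T, hT, hmax⟩ := (isGood_support_of_mem_extremeCouplings hμ).exists_maximal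
    exact ⟨T, hmax, fun p hp => by_contra fun h => hp (hT h)⟩
  choose! T hT hTμ using hex
  have hinj : Set.InjOn T (extremeCouplings G μ₁ μ₂) := fun μ hμ ν hν h =>
    (hT μ hμ).prop.eq_of_couplings (extremePoints_subset hμ) (extremePoints_subset hν) (hTμ μ hμ)
      (h ▸ hTμ ν hν)
  exact ⟨Set.Finite.of_injOn (fun μ hμ => hT μ hμ) hinj (Set.toFinite {S | Maximal (IsGood G) S}),
    Set.ncard_le_ncard_of_injOn T (fun μ hμ => hT μ hμ) hinj (Set.toFinite _)⟩

end ExtremePoints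

end FixedMarginals

/-! ### The multigraph of orbits -/

namespace FixedMarginals

section Orbits
open Finset

variable {G X Y : Type*} [Group G] [MulAction G X] [MulAction G Y]

/-- The `G`-orbit of a point, as an element of the set of orbits. -/
abbrev orbitOf (G : Type*) {Z : Type*} [Group G] [MulAction G Z] (z : Z) :
    MulAction.orbitRel.Quotient G Z :=
  Quotient.mk _ z

theorem orbitOf_eq {Z : Type*} [MulAction G Z] {z z' : Z} :
    orbitOf G z = orbitOf G z' ↔ z ∈ MulAction.orbit G z' :=
  Quotient.eq.trans MulAction.orbitRel_apply

theorem orbitOf_smul {Z : Type*} [MulAction G Z] (g : G) (z : Z) :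
    orbitOf G (g • z) = orbitOf G z :=
  orbitOf_eq.mpr ⟨g, rfl⟩

/-- The orbit of `x`, for an orbit `G(x, y)` in `X × Y`. -/
def orbitFst (o : MulAction.orbitRel.Quotient G (X × Y)) : MulAction.orbitRel.Quotient G X :=
  Quotient.lift (fun p => orbitOf G p.1) (by
    rintro _ p ⟨g, rfl⟩
    exact orbitOf_smul g p.1) o

/-- The orbit of `y`, for an orbit `G(x, y)` in `X × Y`. -/
def orbitSnd (o : MulAction.orbitRel.Quotient G (X × Y)) : MulAction.orbitRel.Quotient G Y :=
  Quotient.lift (fun p => orbitOf G p.2) (by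
    rintro _ p ⟨g, rfl⟩
    exact orbitOf_smul g p.2) o

theorem orbit_subset_prod_iff (o : MulAction.orbitRel.Quotient G (X × Y)) (x : X) (y : Y) :
    o.orbit ⊆ MulAction.orbit G x ×ˢ MulAction.orbit G y ↔
      orbitFst o = orbitOf G x ∧ orbitSnd o = orbitOf G y := by
  induction o using Quotient.inductionOn with | h p =>
  change _ ↔ orbitOf G p.1 = orbitOf G x ∧ orbitOf G p.2 = orbitOf G y
  rw [orbitOf_eq, orbitOf_eq]
  constructor
  · intro h
    exact h (MulAction.mem_orbit_self p)
  · rintro ⟨h1, h2⟩ _ ⟨g, rfl⟩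
    exact ⟨MulAction.mem_orbit_of_mem_orbit g h1, MulAction.mem_orbit_of_mem_orbit g h2⟩

theorem numOrbitsIn_eq_ncard (x : X) (y : Y) :
    numOrbitsIn G x y = ({o | orbitFst o = orbitOf G x ∧ orbitSnd o = orbitOf G y} :
      Set (MulAction.orbitRel.Quotient G (X × Y))).ncard := by
  simp only [numOrbitsIn, orbit_subset_prod_iff]

theorem numOrbitsIn_ne_zero [Finite X] [Finite Y] (x : X) (y : Y) : numOrbitsIn G x y ≠ 0 := by
  rw [numOrbitsIn_eq_ncard]
  exact Set.ncard_ne_zero_of_mem (a := orbitOf G (x, y)) ⟨rfl, rfl⟩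

theorem numOrbitsIn_of_actsTrivially (hX : ActsTrivially G X) (hY : ActsTrivially G Y)
    (x : X) (y : Y) : numOrbitsIn G x y = 1 := by
  rw [numOrbitsIn_eq_ncard, Set.ncard_eq_one]
  refine ⟨orbitOf G (x, y), Set.eq_singleton_iff_unique_mem.mpr ⟨⟨rfl, rfl⟩, ?_⟩⟩
  rintro o ⟨h1, h2⟩
  induction o using Quotient.inductionOn with | h p =>
  obtain ⟨g, hg⟩ := orbitOf_eq.mp (show orbitOf G p.1 = orbitOf G x from h1)
  obtain ⟨k, hk⟩ := orbitOf_eq.mp (show orbitOf G p.2 = orbitOf G y from h2)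
  rw [show orbitOf G (x, y) = orbitOf G p by
    rw [← Prod.mk.eta (p := p), ← hg, ← hk]; simp only [hX g x, hY k y]]

/-- `G`-good sets are the unions of the orbits that form a forest in the bipartite multigraph whose
vertices are the orbits in `X` and in `Y` and whose edges are the orbits in `X × Y`. -/
theorem isGood_preimage_iff (T : Set (MulAction.orbitRel.Quotient G (X × Y))) :
    IsGood G (orbitOf G ⁻¹' T) ↔ Splits orbitFst orbitSnd T := by
  constructor
  · rintro ⟨-, h⟩ f
    obtain ⟨u, v, hu, hv, huv⟩ := h (fun p => f (orbitOf G p)) fun g p _ => by rw [orbitOf_smul]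
    refine ⟨Quotient.lift u ?_, Quotient.lift v ?_, fun o ho => ?_⟩
    · rintro _ x ⟨g, rfl⟩; exact hu g x
    · rintro _ y ⟨g, rfl⟩; exact hv g y
    · induction o using Quotient.inductionOn with | h p => exact huv p ho
  · intro h
    refine ⟨fun g p hp => ?_, fun f hf => ?_⟩
    · rwa [Set.mem_preimage, orbitOf_smul]
    · classical
      obtain ⟨u, v, huv⟩ := h (Quotient.lift
        (fun p => if orbitOf G p ∈ T then f p else 0) (by
          rintro _ p ⟨g, rfl⟩
          simp only [orbitOf_smul]
          split_ifs with hp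
          · exact hf g p hp
          · rfl))
      refine ⟨fun x => u (orbitOf G x), fun y => v (orbitOf G y), fun g x =>
        congrArg u (orbitOf_smul g x), fun g y => congrArg v (orbitOf_smul g y), fun p hp => ?_⟩
      have := huv (orbitOf G p) hp
      rw [Quotient.lift_mk, if_pos (Set.mem_preimage.mp hp)] at this
      exact this

theorem preimage_image_orbitOf {S : Set (X × Y)} (hS : ∀ (g : G), ∀ p ∈ S, g • p ∈ S) :
    orbitOf G ⁻¹' (orbitOf G '' S) = S := by
  refine Set.Subset.antisymm ?_ (Set.subset_preimage_image _ _)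
  rintro p ⟨p', hp', h⟩
  obtain ⟨g, rfl⟩ := orbitOf_eq.mp h.symm
  exact hS g p' hp'

theorem numMaximalGood_eq_ncard :
    numMaximalGood G X Y = ({T | Maximal (Splits orbitFst orbitSnd) T} :
      Set (Set (MulAction.orbitRel.Quotient G (X × Y)))).ncard := by
  have hsurj : Function.Surjective (orbitOf G : X × Y → _) := Quotient.mk_surjective
  have hset : {S : Set (X × Y) | Maximal (IsGood G) S} =
      (fun T => orbitOf G ⁻¹' T) '' {T | Maximal (Splits orbitFst orbitSnd) T} := by
    ext S
    constructor
    · intro hS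
      have hpre := preimage_image_orbitOf hS.prop.1
      refine ⟨orbitOf G '' S, ⟨?_, fun T hT hle => ?_⟩, hpre⟩
      · rw [← isGood_preimage_iff, hpre]
        exact hS.prop
      · have h := hS.le_of_ge ((isGood_preimage_iff T).mpr hT)
          (by rw [← hpre]; exact Set.preimage_mono hle)
        rw [← Set.image_preimage_eq T hsurj]
        exact Set.image_mono h
    · rintro ⟨T, hT, rfl⟩
      refine ⟨(isGood_preimage_iff T).mpr hT.prop, fun S hS hle => ?_⟩
      have hpre := preimage_image_orbitOf hS.1
      rw [← hpre] at hS hle ⊢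
      exact Set.preimage_mono (hT.le_of_ge ((isGood_preimage_iff _).mp hS)
        ((Set.preimage_subset_preimage_iff (by simp [hsurj.range_eq])).mp hle))
  rw [numMaximalGood, hset, Set.ncard_image_of_injective _ (Set.preimage_injective.mpr hsurj)]

theorem numOrbits_prod_and_numMaximalGood [Finite X] [Finite Y] [Nonempty X] [Nonempty Y] {a : ℕ}
    (ha : ∀ (x : X) (y : Y), numOrbitsIn G x y = a) :
    numOrbits G (X × Y) = a * numOrbits G X * numOrbits G Y ∧
      numMaximalGood G X Y = a ^ (numOrbits G X + numOrbits G Y - 1) *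
        numOrbits G X ^ (numOrbits G Y - 1) * numOrbits G Y ^ (numOrbits G X - 1) := by
  classical
  have := Fintype.ofFinite (MulAction.orbitRel.Quotient G X)
  have := Fintype.ofFinite (MulAction.orbitRel.Quotient G Y)
  have := Fintype.ofFinite (MulAction.orbitRel.Quotient G (X × Y))
  have : Nonempty (MulAction.orbitRel.Quotient G X) := ‹Nonempty X›.map (orbitOf G)
  have : Nonempty (MulAction.orbitRel.Quotient G Y) := ‹Nonempty Y›.map (orbitOf G)
  have hfib : ∀ (x : MulAction.orbitRel.Quotient G X) (y : MulAction.orbitRel.Quotient G Y),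
      #{o : MulAction.orbitRel.Quotient G (X × Y) | orbitFst o = x ∧ orbitSnd o = y} = a := by
    intro x y
    induction x using Quotient.inductionOn with | h x =>
    induction y using Quotient.inductionOn with | h y =>
    rw [← ha x y, numOrbitsIn_eq_ncard, ← Set.ncard_coe_finset]
    congr 1
    ext o
    simp
  obtain ⟨x⟩ := ‹Nonempty X›
  obtain ⟨y⟩ := ‹Nonempty Y›
  have ha0 : a ≠ 0 := ha x y ▸ numOrbitsIn_ne_zero x y
  simp only [numOrbits, Nat.card_eq_fintype_card]
  refine ⟨?_, numMaximalGood_eq_ncard.trans (ncard_maximal_splits ha0 hfib)⟩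
  rw [← Finset.card_univ (α := MulAction.orbitRel.Quotient G (X × Y)),
    Finset.card_eq_sum_card_fiberwise (f := orbitFst) (t := univ) fun _ _ => by simp]
  simp only [card_left_fibre hfib, Finset.sum_const, Finset.card_univ, smul_eq_mul]
  ring

end Orbits

end FixedMarginals

/-! ### Comparison with the binomial coefficient -/

section BinomialRatio

theorem pow_mul_descFactorial_le (a N k : ℕ) :
    a ^ k * N.descFactorial k ≤ (a * N).descFactorial k := by
  rcases Nat.eq_zero_or_pos a with rfl | ha
  · cases k <;> simp
  induction k with
  | zero => simp
  | succ k ih =>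
    rw [Nat.descFactorial_succ, Nat.descFactorial_succ]
    have h : a * (N - k) ≤ a * N - k := by
      rw [Nat.mul_sub]
      exact Nat.sub_le_sub_left (Nat.le_mul_of_pos_left k ha) _
    calc a ^ (k + 1) * ((N - k) * N.descFactorial k)
        = (a * (N - k)) * (a ^ k * N.descFactorial k) := by ring
      _ ≤ _ := Nat.mul_le_mul h ih

theorem pow_mul_choose_le (a N k : ℕ) : a ^ k * N.choose k ≤ (a * N).choose k := by
  have h := pow_mul_descFactorial_le a N k
  rw [Nat.descFactorial_eq_factorial_mul_choose, Nat.descFactorial_eq_factorial_mul_choose] at h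
  exact Nat.le_of_mul_le_mul_left (by linarith) k.factorial_pos

end BinomialRatio

namespace FixedMarginals

/-- The common number `a` of orbits in a product of orbits cancels from the bound. -/
theorem extremeCouplings_ratio_le {G X Y : Type*} [Group G] [Fintype X] [Fintype Y]
    [MulAction G X] [MulAction G Y] [Nonempty X] [Nonempty Y] (μ₁ : X → ℝ) (μ₂ : Y → ℝ) {a : ℕ}
    (ha : ∀ (x : X) (y : Y), numOrbitsIn G x y = a) (hX : 1 ≤ numOrbits G X)
    (hY : 1 ≤ numOrbits G Y) :
    ((extremeCouplings G μ₁ μ₂).ncard : ℝ) /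
        ((numOrbits G (X × Y)).choose (numOrbits G X + numOrbits G Y - 1) : ℝ) ≤
      (numOrbits G X : ℝ) ^ (numOrbits G Y - 1) * (numOrbits G Y : ℝ) ^ (numOrbits G X - 1) /
        ((numOrbits G X * numOrbits G Y).choose (numOrbits G X + numOrbits G Y - 1) : ℝ) := by
  obtain ⟨h12, hmax⟩ := numOrbits_prod_and_numMaximalGood ha
  have hE := (extremeCouplings_finite_and_ncard_le (G := G) μ₁ μ₂).2
  obtain ⟨x⟩ := ‹Nonempty X›
  obtain ⟨y⟩ := ‹Nonempty Y›
  have ha0 : 0 < a := Nat.pos_of_ne_zero (ha x y ▸ numOrbitsIn_ne_zero x y)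
  rw [h12, mul_assoc a]
  rw [hmax] at hE
  generalize numOrbits G X = m at *
  generalize numOrbits G Y = n at *
  have hle : m + n - 1 ≤ m * n := by
    obtain ⟨k, rfl⟩ := Nat.exists_eq_add_of_le hX
    obtain ⟨l, rfl⟩ := Nat.exists_eq_add_of_le hY
    have : (1 + k) * (1 + l) = 1 + k + l + k * l := by ring
    omega
  have hc : 0 < (m * n).choose (m + n - 1) := Nat.choose_pos hle
  have hca := pow_mul_choose_le a (m * n) (m + n - 1)
  have hca0 : 0 < a ^ (m + n - 1) * (m * n).choose (m + n - 1) := by positivity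
  rw [div_le_div_iff₀ (by exact_mod_cast hca0.trans_le hca) (by exact_mod_cast hc)]
  norm_cast
  calc _ ≤ (a ^ (m + n - 1) * m ^ (n - 1) * n ^ (m - 1)) * (m * n).choose (m + n - 1) := by gcongr
    _ = (m ^ (n - 1) * n ^ (m - 1)) * (a ^ (m + n - 1) * (m * n).choose (m + n - 1)) := by ring
    _ ≤ _ := by gcongr

end FixedMarginals

theorem mainTheorem3 :
    -- the Stirling estimate
    (∃ C : ℝ, ∀ m n : ℕ, 2 ≤ m → 2 ≤ n →
      (m : ℝ) ^ (n - 1) * (n : ℝ) ^ (m - 1) / (Nat.choose (m * n) (m + n - 1) : ℝ) ≤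
        C * (((1 - 1 / (m : ℝ)) ^ (m * n) * (1 + (n : ℝ) / m) ^ m *
              (1 - 1 / (n : ℝ)) ^ (m * n) * (1 + (m : ℝ) / n) ^ n) /
            ((1 - 1 / (m : ℝ)) ^ n * (1 - 1 / (n : ℝ)) ^ m * √((m : ℝ) + n)))) ∧
    -- the limit of the numerical ratio
    Tendsto (fun p : ℕ × ℕ =>
        (p.1 : ℝ) ^ (p.2 - 1) * (p.2 : ℝ) ^ (p.1 - 1) /
          (Nat.choose (p.1 * p.2) (p.1 + p.2 - 1) : ℝ))
      (atTop ×ˢ atTop) (𝓝 0) ∧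
    -- the counts for a trivial action
    (∀ (G X Y : Type*) [Group G] [Fintype X] [Fintype Y] [Nonempty X] [Nonempty Y]
        [MulAction G X] [MulAction G Y],
      FixedMarginals.ActsTrivially G X → FixedMarginals.ActsTrivially G Y →
      FixedMarginals.numOrbits G (X × Y) =
          FixedMarginals.numOrbits G X * FixedMarginals.numOrbits G Y ∧
      FixedMarginals.numMaximalGood G X Y =
          FixedMarginals.numOrbits G X ^ (FixedMarginals.numOrbits G Y - 1) *
          FixedMarginals.numOrbits G Y ^ (FixedMarginals.numOrbits G X - 1)) ∧
    -- the counts when every product of orbits contains the same number of orbits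
    (∀ (G X Y : Type*) [Group G] [Fintype X] [Fintype Y] [Nonempty X] [Nonempty Y]
        [MulAction G X] [MulAction G Y] (a : ℕ),
      (∀ (x : X) (y : Y), FixedMarginals.numOrbitsIn G x y = a) →
      FixedMarginals.numOrbits G (X × Y) =
          a * FixedMarginals.numOrbits G X * FixedMarginals.numOrbits G Y ∧
      FixedMarginals.numMaximalGood G X Y =
          a ^ (FixedMarginals.numOrbits G X + FixedMarginals.numOrbits G Y - 1) *
          FixedMarginals.numOrbits G X ^ (FixedMarginals.numOrbits G Y - 1) *
          FixedMarginals.numOrbits G Y ^ (FixedMarginals.numOrbits G X - 1)) ∧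
    -- extreme points are at most as many as maximal good sets
    (∀ (G X Y : Type*) [Group G] [Fintype X] [Fintype Y] [MulAction G X] [MulAction G Y]
        (μ₁ : X → ℝ) (μ₂ : Y → ℝ),
      μ₁ ∈ FixedMarginals.invariantProb G X → μ₂ ∈ FixedMarginals.invariantProb G Y →
      (∀ x, 0 < μ₁ x) → (∀ y, 0 < μ₂ y) →
      (FixedMarginals.extremeCouplings G μ₁ μ₂).Finite ∧
      (FixedMarginals.extremeCouplings G μ₁ μ₂).ncard ≤
        FixedMarginals.numMaximalGood G X Y) ∧
    -- the limit of the ratio for extreme points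
    (∀ ε : ℝ, 0 < ε → ∃ N : ℕ,
      ∀ (G X Y : Type*) [Group G] [Fintype X] [Fintype Y] [MulAction G X] [MulAction G Y]
        (μ₁ : X → ℝ) (μ₂ : Y → ℝ),
      μ₁ ∈ FixedMarginals.invariantProb G X → μ₂ ∈ FixedMarginals.invariantProb G Y →
      (∀ x, 0 < μ₁ x) → (∀ y, 0 < μ₂ y) →
      ((FixedMarginals.ActsTrivially G X ∧ FixedMarginals.ActsTrivially G Y) ∨
        (∃ a : ℕ, ∀ (x : X) (y : Y), FixedMarginals.numOrbitsIn G x y = a)) →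
      N ≤ FixedMarginals.numOrbits G X → N ≤ FixedMarginals.numOrbits G Y →
      ((FixedMarginals.extremeCouplings G μ₁ μ₂).ncard : ℝ) /
          (Nat.choose (FixedMarginals.numOrbits G (X × Y))
            (FixedMarginals.numOrbits G X + FixedMarginals.numOrbits G Y - 1) : ℝ) < ε) := by
  refine ⟨⟨Real.exp 1 ^ 3, fun m n hm hn => ?_⟩, tendsto_ratio, ?_, ?_, ?_, ?_⟩
  · refine (ratio_le_stirlingFactor hm hn).trans_eq ?_
    rw [stirlingFactor, stirlingFactor, mul_comm n m, div_mul_div_comm, div_div]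
    simp only [mul_assoc]
  · intro G X Y _ _ _ _ _ _ _ hX hY
    simpa using FixedMarginals.numOrbits_prod_and_numMaximalGood
      (FixedMarginals.numOrbitsIn_of_actsTrivially hX hY)
  · intro G X Y _ _ _ _ _ _ _ a ha
    exact FixedMarginals.numOrbits_prod_and_numMaximalGood ha
  · intro G X Y _ _ _ _ _ μ₁ μ₂ _ _ _ _
    exact FixedMarginals.extremeCouplings_finite_and_ncard_le μ₁ μ₂
  · intro ε hε
    have hev := (tendsto_ratio.eventually (gt_mem_nhds hε))
    rw [prod_atTop_atTop_eq, eventually_atTop] at hev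
    obtain ⟨⟨M, N⟩, hMN⟩ := hev
    refine ⟨M + N + 1, ?_⟩
    intro G X Y _ _ _ _ _ μ₁ μ₂ hμ₁ hμ₂ _ _ h hm hn
    -- the point masses sum to `1`, so neither set is empty
    have : Nonempty X := by
      by_contra hX
      rw [not_nonempty_iff] at hX
      simpa using hμ₁.1.2
    have : Nonempty Y := by
      by_contra hY
      rw [not_nonempty_iff] at hY
      simpa using hμ₂.1.2
    obtain ⟨a, ha⟩ : ∃ a : ℕ, ∀ (x : X) (y : Y), FixedMarginals.numOrbitsIn G x y = a := by
      rcases h with ⟨hX, hY⟩ | h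
      · exact ⟨1, FixedMarginals.numOrbitsIn_of_actsTrivially hX hY⟩
      · exact h
    have hM : M ≤ FixedMarginals.numOrbits G X := by omega
    have hN : N ≤ FixedMarginals.numOrbits G Y := by omega
    exact (FixedMarginals.extremeCouplings_ratio_le μ₁ μ₂ ha (by omega) (by omega)).trans_lt
      (hMN (FixedMarginals.numOrbits G X, FixedMarginals.numOrbits G Y) ⟨hM, hN⟩)
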